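/- **Definitions.** Let $\{M_b\}_{b\in B}$ be a POVM with finitely many outcomes on $\mathbb C^d$. Its *noncontextual measurement-assignment polytope* $\mathbb P_M$ is the set of probability vectors $(p(b))_{b}$ such that $\sum_b\beta_b p(b)=0$ for all real $(\beta_b)$ with $\sum_b\beta_b M_b=0$. The POVM is *classical* if the prepare-measure experiment that combines it with the set of all density matrices $\rho$ has a noncontextual ontological model, i.e. there are a set $\Lambda$, response functions $p(\cdot|\lambda)$ (probability vectors on $B$) and, for every $\rho$, a probability distribution $p(\cdot|\rho)$ on $\Lambda$ with $\mathrm{Tr}[M_b\rho]=\sum_\lambda p(b|\lambda)p(\lambda|\rho)$ for all $b,\rho$, such that every real linear relation among the effects is satisfied by the response functions at every $\lambda$ (that is, $p(\cdot|\lambda)\in\mathbb P_M$), and every finite real linear relation $\sum_i\alpha_i\rho_i=0$ among states gives $\sum_i\alpha_i p(\lambda|\rho_i)=0$ for every $\lambda$. For $\eta\in[0,1]$ put $M_b^\eta=\eta M_b+(1-\eta)\frac{\mathrm{Tr}M_b}{d}\mathbb 1$; the *white-noise robustness* of $\{M_b\}$ is the supremum of the $\eta\in[0,1]$ for which $\{M^\eta_b\}$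 is classical. The *dual program* of $\{M_b\}$ is to minimise $1+\sum_b\mathrm{Tr}[X_bM_b]$ over Hermitian $\{X_b\}$ with $1+\sum_b\mathrm{Tr}[X_bM_b]\ge\frac1d\sum_b\mathrm{Tr}X_b\,\mathrm{Tr}M_b$ and $\sum_b D(b)X_b\ge0$ for every extreme point $D$ of $\mathbb P_M$. **Statement.** For $k\ge2$ let $$M_b=\tfrac1k\left[\mathbb 1+\cos\theta_b\,\sigma_x+\sin\theta_b\,\sigma_z\right],\qquad \theta_b=\tfrac{2\pi b}{k},\qquad b=1,\dots,k .$$ Then $\{M_b\}_{b=1}^k$ is a POVM on $\mathbb C^2$. 1. If $k\in\{2,3\}$, then $\{M_b\}$ is classical, and its white-noise robustness is $1$. 2. If $k\ge4$, put $\eta_k=\frac{1}{2\cos(\pi/k)}$. Then: (a) the white-noise robustness of $\{M_b\}$ is $\eta_k$; moreover, for $0\le\eta\le1$, $\{M_b^\eta\}$ is classical if and only if $\eta\le\eta_k$; (b) $\eta_k$ is the minimum of the dual program of $\{M_b\}$, and it is attained at variables of the form $X_b=\alpha\mathbb 1-\beta M_b$ with $\alpha,\beta\in\mathbb R$; furthermore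 $\eta_k=\frac{k\Lambda-1}{d-1}$ with $d=2$, where $\Lambda$ is the maximum over extreme points $D$ of $\mathbb P_M$ of the spectral norm of $\sum_bD(b)M_b$; (c) with $G_\lambda=\frac1k[\mathbb 1+\cos\varphi_\lambda\,\sigma_x+\sin\varphi_\lambda\,\sigma_z]$, where $\lambda=1,\dots,k$ and $\varphi_\lambda=\frac{2\pi\lambda}{k}$ if $k$ is odd, $\varphi_\lambda=\frac{2\pi\lambda+\pi}{k}$ if $k$ is even, $\{G_\lambda\}$ is a POVM, and there are extreme points $D(\cdot|\lambda)$ of $\mathbb P_M$ such that $M_b^{\eta_k}=\sum_\lambda D(b|\lambda)G_\lambda$ for every $b$. -/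

import Mathlib

open scoped ComplexOrder

noncomputable section

namespace NCMeas

variable {n : Type} [Fintype n] [DecidableEq n]

/-- A (normalised) quantum state on the Hilbert space `ℂⁿ`: a density matrix. -/
def QState (n : Type) [Fintype n] : Type :=
  {ρ : Matrix n n ℂ // ρ.PosSemidef ∧ ρ.trace = 1}

/-- A positive operator-valued measure with outcome set `B`. -/
def IsPOVM {B : Type} [Fintype B] (M : B → Matrix n n ℂ) : Prop :=
  (∀ b, (M b).PosSemidef) ∧ ∑ b, M b = 1

/-- A noncontextual ontological model, with set of ontic states `Λ`, of the prepare-measure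
experiment with multi-source `P` and multi-measurement `M`.
Here `P x a` is the unnormalised state `p(a|x) ρ_{a|x}` (so that its trace is `p(a|x)`),
`prep x a l` is `p(a,l|x)`, and `resp y l b` is `p(b|y,l)`.  Operational identities are finite
real-linear relations. -/
structure OntologicalModel {X A Y B : Type} [Fintype B]
    (P : X → A → Matrix n n ℂ) (M : Y → B → Matrix n n ℂ) (Λ : Type) where
  prep : X → A → Λ → ℝ
  resp : Y → Λ → B → ℝ
  prep_nonneg : ∀ x a l, 0 ≤ prep x a l
  prep_hasSum : ∀ x a, HasSum (fun l => prep x a l) (P x a).trace.re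
  resp_nonneg : ∀ y l b, 0 ≤ resp y l b
  resp_sum : ∀ y l, ∑ b, resp y l b = 1
  /-- the model reproduces the quantum statistics -/
  reproduces : ∀ x a y b,
    HasSum (fun l => resp y l b * prep x a l) (M y b * P x a).trace.re
  /-- operational identities among the effects are respected by the response functions -/
  resp_identities : ∀ β : Y × B →₀ ℝ,
    (β.sum fun yb r => r • M yb.1 yb.2) = 0 →
      ∀ l, (β.sum fun yb r => r * resp yb.1 l yb.2) = 0
  /-- operational identities among the preparations are respected by the distributions -/
  prep_identities : ∀ α : X × A →₀ ℝ,
    (α.sum fun xa r => r • P xa.1 xa.2) = 0 →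
      ∀ l, (α.sum fun xa r => r * prep xa.1 xa.2 l) = 0

/-- The experiment is classically explainable: it has a noncontextual ontological model. -/
def ClassicallyExplainable {X A Y B : Type} [Fintype B]
    (P : X → A → Matrix n n ℂ) (M : Y → B → Matrix n n ℂ) : Prop :=
  ∃ Λ : Type, Nonempty (OntologicalModel P M Λ)

/-- The multi-source which prepares every quantum state (setting `ρ`, trivial outcome). -/
def allStates (n : Type) [Fintype n] : QState n → Unit → Matrix n n ℂ :=
  fun ρ _ => ρ.1

/-- A multi-measurement is classical if the statistics which it generates together with the set
of all quantum states are consistent with noncontextuality. -/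
def IsClassicalMulti {Y B : Type} [Fintype B] (M : Y → B → Matrix n n ℂ) : Prop :=
  ClassicallyExplainable (allStates n) M

/-- Classicality of a single measurement (trivial setting). -/
def IsClassical {B : Type} [Fintype B] (M : B → Matrix n n ℂ) : Prop :=
  IsClassicalMulti (fun _ : Unit => M)

/-- The white-noise version `M_b^η = η M_b + (1 - η) (Tr M_b / d) 𝟙`. -/
def noisy {B : Type} (M : B → Matrix n n ℂ) (η : ℝ) : B → Matrix n n ℂ :=
  fun b => (η : ℂ) • M b +
    (((1 - η : ℝ) : ℂ) * ((M b).trace / (Fintype.card n : ℂ))) • (1 : Matrix n n ℂ)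

/-- The white-noise robustness: the supremum of the `η ∈ [0,1]` at which the noisy measurement
is classical (for a POVM, `η = 0` is always such a value). -/
def whiteNoiseRobustness {B : Type} [Fintype B] (M : B → Matrix n n ℂ) : ℝ :=
  sSup {η : ℝ | η ∈ Set.Icc (0 : ℝ) 1 ∧ IsClassical (noisy M η)}

/-- The noncontextual measurement-assignment polytope of a single measurement. -/
def assignmentPolytope {B : Type} [Fintype B] (M : B → Matrix n n ℂ) : Set (B → ℝ) :=
  {p | (∀ b, 0 ≤ p b) ∧ ∑ b, p b = 1 ∧
    ∀ β : B → ℝ, ∑ b, β b • M b = 0 → ∑ b, β b * p b = 0}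

/-- The extreme points of the assignment polytope. -/
def vertexAssignments {B : Type} [Fintype B] (M : B → Matrix n n ℂ) : Set (B → ℝ) :=
  Set.extremePoints ℝ (assignmentPolytope M)

/-- Feasibility of Hermitian variables `X_b` in the dual semidefinite program. -/
def DualFeasible {B : Type} [Fintype B] (M X : B → Matrix n n ℂ) : Prop :=
  (∀ b, (X b).IsHermitian) ∧
  (1 / (Fintype.card n : ℝ)) * ∑ b, (X b).trace.re * (M b).trace.re
    ≤ 1 + ∑ b, (X b * M b).trace.re ∧
  ∀ D ∈ vertexAssignments M, (∑ b, D b • X b).PosSemidef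

/-- The objective `1 + ∑_b Tr[X_b M_b]` of the dual semidefinite program. -/
def dualObjective {B : Type} [Fintype B] (M X : B → Matrix n n ℂ) : ℝ :=
  1 + ∑ b, (X b * M b).trace.re

/-- The spectral norm: the operator norm on Euclidean space. -/
def spectralNorm (A : Matrix n n ℂ) : ℝ :=
  ‖Matrix.toEuclideanCLM (n := n) (𝕜 := ℂ) A‖

/-- The Pauli matrix `σ_x`. -/
def σx : Matrix (Fin 2) (Fin 2) ℂ := !![0, 1; 1, 0]

/-- The Pauli matrix `σ_z`. -/
def σz : Matrix (Fin 2) (Fin 2) ℂ := !![1, 0; 0, -1]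

/-- `(1/k) [𝟙 + cos θ σ_x + sin θ σ_z]`. -/
def planarEffect (k : ℕ) (θ : ℝ) : Matrix (Fin 2) (Fin 2) ℂ :=
  (1 / (k : ℝ)) • (1 + Real.cos θ • σx + Real.sin θ • σz)

/-- The symmetric planar measurement; the index `i : Fin k` is the outcome `b = i + 1`, so that
`b` runs through `1, …, k`. -/
def planar (k : ℕ) : Fin k → Matrix (Fin 2) (Fin 2) ℂ :=
  fun i => planarEffect k (2 * Real.pi * ((i : ℕ) + 1 : ℝ) / k)

/-- The planar measurement if `k` is odd, and its rotation by `π / k` if `k` is even. -/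
def planarParent (k : ℕ) : Fin k → Matrix (Fin 2) (Fin 2) ℂ :=
  fun i =>
    if Even k then planarEffect k ((2 * Real.pi * ((i : ℕ) + 1 : ℝ) + Real.pi) / k)
    else planarEffect k (2 * Real.pi * ((i : ℕ) + 1 : ℝ) / k)

end NCMeas

end

/-! For `k ≥ 3`, the relations among the effects force an assignment to be `p b = (1 + x cos θ_b + y
sin θ_b)/k`, where `(x, y)` is twice the mean direction under `p` (`assignment_eq`). Positivity
confines `(x, y)` to a regular `k`-gon with inradius 1 and circumradius `1 / cos (π/k)`
(`assignment_radius`). With `κ = 1 / (2 cos (π/k))`, mean directions thus have length at most `κ`,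
and corners of the polygon give extreme points of the polytope. Every bound below comes from this
radius.

Classicality up to `κ`: the parent effects point towards the corners, and trigonometric
orthogonality shows that post-processing them with weights `(1 + 2η cos)/k` reproduces the noisy
effects (`sum_smul_planarParent`). The weights are nonnegative up to `η = κ`, where they are
vertices.

Optimality: in any model, fix an ontic state with response `p`. The mixture of the pure states `ρ_b`
with weights `p b` has a Bloch vector of length at most `κ`, so adding `κ` times a suitable state
yields `1 + κ` times the maximally mixed state. Preparation noncontextuality bounds the weighted sum
of the `ρ_b`-probabilities, and summing over ontic states gives `1 + η ≤ 1 + κ`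
(`le_of_isClassical_noisy_planar`). No parent POVM has to be extracted from the model.

The critical simulation also gives weak duality (`le_dualObjective`), and the radius bound yields a
matching dual point and the spectral norm. For `k = 2, 3` the effects are linearly independent, so
nothing constrains the assignments. -/

noncomputable section
namespace NCMeas

/-! ### Real combinations of `𝟙`, `σ_x`, `σ_z`: positivity, traces, norms -/

/-- The real combination `a 𝟙 + x σ_x + y σ_z`. -/
def bloch (a x y : ℝ) : Matrix (Fin 2) (Fin 2) ℂ :=
  a • (1 : Matrix (Fin 2) (Fin 2) ℂ) + x • σx + y • σz

lemma bloch_eq (a x y : ℝ) :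
    bloch a x y = !![((a + y : ℝ) : ℂ), (x : ℂ); (x : ℂ), ((a - y : ℝ) : ℂ)] := by
  ext i j
  fin_cases i <;> fin_cases j <;> simp [bloch, σx, σz, sub_eq_add_neg]

lemma bloch_add (a x y a' x' y' : ℝ) :
    bloch a x y + bloch a' x' y' = bloch (a + a') (x + x') (y + y') := by
  simp only [bloch, add_smul]; abel

lemma smul_bloch (r a x y : ℝ) : r • bloch a x y = bloch (r * a) (r * x) (r * y) := by
  simp only [bloch, smul_add, smul_smul]

lemma bloch_one : bloch 1 0 0 = 1 := by simp [bloch]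

lemma bloch_zero : bloch 0 0 0 = 0 := by simp [bloch]

lemma sum_bloch {ι : Type*} (s : Finset ι) (a x y : ι → ℝ) :
    ∑ i ∈ s, bloch (a i) (x i) (y i) =
      bloch (∑ i ∈ s, a i) (∑ i ∈ s, x i) (∑ i ∈ s, y i) := by
  simp only [bloch, Finset.sum_add_distrib, Finset.sum_smul]

lemma bloch_inj {a x y a' x' y' : ℝ} :
    bloch a x y = bloch a' x' y' ↔ a = a' ∧ x = x' ∧ y = y' := by
  refine ⟨fun h => ?_, by rintro ⟨rfl, rfl, rfl⟩; rfl⟩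
  rw [bloch_eq, bloch_eq] at h
  have h0 := congrFun (congrFun h 0) 0
  have h1 := congrFun (congrFun h 0) 1
  have h2 := congrFun (congrFun h 1) 1
  simp only [Matrix.of_apply, Matrix.cons_val', Matrix.cons_val_zero, Matrix.cons_val_one,
    Matrix.cons_val_fin_one] at h0 h1 h2
  norm_cast at h0 h1 h2
  exact ⟨by linarith, h1, by linarith⟩

lemma bloch_eq_zero {a x y : ℝ} : bloch a x y = 0 ↔ a = 0 ∧ x = 0 ∧ y = 0 := by
  rw [← bloch_zero, bloch_inj]

lemma bloch_isHermitian (a x y : ℝ) : (bloch a x y).IsHermitian := by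
  rw [bloch_eq]
  ext i j
  fin_cases i <;> fin_cases j <;> simp [Matrix.conjTranspose_apply]

lemma bloch_trace (a x y : ℝ) : (bloch a x y).trace = ((2 * a : ℝ) : ℂ) := by
  rw [bloch_eq, Matrix.trace_fin_two]
  simp; ring

lemma bloch_mul_trace (a x y a' x' y' : ℝ) :
    (bloch a x y * bloch a' x' y').trace = ((2 * (a * a' + x * x' + y * y') : ℝ) : ℂ) := by
  rw [bloch_eq, bloch_eq, Matrix.trace_fin_two]
  simp [Matrix.mul_apply, Fin.sum_univ_two]; ring

lemma bloch_mul_self (a x y : ℝ) :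
    bloch a x y * bloch a x y = bloch (a ^ 2 + (x ^ 2 + y ^ 2)) (2 * a * x) (2 * a * y) := by
  rw [bloch_eq, bloch_eq]
  ext i j
  fin_cases i <;> fin_cases j <;> simp [Matrix.mul_apply, Fin.sum_univ_two] <;> ring

/-- Cayley–Hamilton gives `A² = 2a A - (a² - x² - y²) 𝟙`. For `a > 0` this writes `A` as a positive
multiple of `A†A` plus a nonnegative multiple of the identity. -/
lemma bloch_posSemidef {a x y : ℝ} (ha : 0 ≤ a) (h : x ^ 2 + y ^ 2 ≤ a ^ 2) :
    (bloch a x y).PosSemidef := by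
  rcases ha.eq_or_lt with rfl | ha
  · have hx : x = 0 := by nlinarith [sq_nonneg x, sq_nonneg y]
    have hy : y = 0 := by nlinarith [sq_nonneg x, sq_nonneg y]
    rw [hx, hy, bloch_zero]
    exact Matrix.PosSemidef.zero
  · have key : bloch a x y = (1 / (2 * a)) • ((bloch a x y).conjTranspose * bloch a x y +
        (a ^ 2 - (x ^ 2 + y ^ 2)) • (1 : Matrix (Fin 2) (Fin 2) ℂ)) := by
      rw [(bloch_isHermitian a x y).eq, bloch_mul_self, ← bloch_one, smul_bloch, bloch_add,
        smul_bloch, bloch_inj]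
      refine ⟨?_, ?_, ?_⟩ <;> field_simp <;> ring
    rw [key]
    exact ((Matrix.posSemidef_conjTranspose_mul_self _).add
      (Matrix.PosSemidef.one.smul (by linarith))).smul (by positivity)

open scoped MatrixOrder Matrix.Norms.L2Operator in
lemma trace_mul_re_nonneg {n : Type} [Fintype n] [DecidableEq n] {A B : Matrix n n ℂ}
    (hA : A.PosSemidef) (hB : B.PosSemidef) : 0 ≤ (A * B).trace.re := by
  obtain ⟨C, rfl⟩ := CStarAlgebra.nonneg_iff_eq_star_mul_self.mp hB.nonneg
  rw [Matrix.star_eq_conjTranspose, ← Matrix.mul_assoc, Matrix.trace_mul_comm, ← Matrix.mul_assoc]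
  exact (Complex.nonneg_iff.mp (hA.mul_mul_conjTranspose_same C).trace_nonneg).1

/-- A traceless combination squares to a scalar, so the C*-identity gives its norm. -/
lemma norm_toEuclideanCLM_bloch_zero (x y : ℝ) :
    ‖Matrix.toEuclideanCLM (n := Fin 2) (𝕜 := ℂ) (bloch 0 x y)‖ = √(x ^ 2 + y ^ 2) := by
  set T := Matrix.toEuclideanCLM (n := Fin 2) (𝕜 := ℂ)
  have h0 : 0 ≤ x ^ 2 + y ^ 2 := by positivity
  refine (mul_self_inj (norm_nonneg _) (Real.sqrt_nonneg _)).mp ?_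
  rw [← CStarRing.norm_star_mul_self, ← map_star, ← map_mul, Matrix.star_eq_conjTranspose,
    (bloch_isHermitian 0 x y).eq, bloch_mul_self, Real.mul_self_sqrt h0]
  have : bloch (0 ^ 2 + (x ^ 2 + y ^ 2)) (2 * 0 * x) (2 * 0 * y) =
      ((x ^ 2 + y ^ 2 : ℝ) : ℂ) • 1 := by
    rw [Complex.coe_smul, ← bloch_one, smul_bloch]; simp
  rw [this, map_smul, map_one, norm_smul, norm_one, Complex.norm_real, Real.norm_eq_abs,
    abs_of_nonneg h0, mul_one]

lemma spectralNorm_bloch_le {a x y : ℝ} (ha : 0 ≤ a) :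
    spectralNorm (bloch a x y) ≤ a + √(x ^ 2 + y ^ 2) := by
  set T := Matrix.toEuclideanCLM (n := Fin 2) (𝕜 := ℂ)
  have hdec : bloch a x y = (a : ℂ) • 1 + bloch 0 x y := by
    rw [Complex.coe_smul, ← bloch_one, smul_bloch, bloch_add]; simp
  calc spectralNorm (bloch a x y) = ‖T ((a : ℂ) • 1 + bloch 0 x y)‖ := by
        rw [← hdec]; rfl
    _ ≤ ‖T ((a : ℂ) • 1)‖ + ‖T (bloch 0 x y)‖ := by rw [map_add]; exact norm_add_le _ _
    _ = a + √(x ^ 2 + y ^ 2) := by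
        rw [norm_toEuclideanCLM_bloch_zero, map_smul, map_one, norm_smul, norm_one,
          Complex.norm_real, Real.norm_eq_abs, abs_of_nonneg ha, mul_one]

lemma spectralNorm_bloch {a x y s : ℝ} (ha : 0 ≤ a) (hs : 0 < s) (h : x ^ 2 + y ^ 2 = s ^ 2) :
    spectralNorm (bloch a x y) = a + s := by
  set T := Matrix.toEuclideanCLM (n := Fin 2) (𝕜 := ℂ)
  apply le_antisymm
  · have := spectralNorm_bloch_le (x := x) (y := y) ha
    rwa [h, Real.sqrt_sq hs.le] at this
  -- `bloch s x y` is a multiple of the projector onto the top eigenvector. Multiplying by it scales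
  -- by the eigenvalue `a + s`, and submultiplicativity of the norm gives the lower bound.
  · have hne : T (bloch s x y) ≠ 0 := by
      rw [Ne, map_eq_zero_iff T T.injective, bloch_eq_zero]
      exact fun h => hs.ne' h.1
    have hmul : bloch a x y * bloch s x y = ((a + s : ℝ) : ℂ) • bloch s x y := by
      have hdec : bloch a x y = (a - s) • 1 + bloch s x y := by
        rw [← bloch_one, smul_bloch, bloch_add]; simp
      rw [Complex.coe_smul, hdec, add_mul, bloch_mul_self, smul_mul_assoc, one_mul, smul_bloch,
        smul_bloch, bloch_add, bloch_inj, h]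
      refine ⟨?_, ?_, ?_⟩ <;> ring
    have hle : ‖T (bloch a x y * bloch s x y)‖ ≤ spectralNorm (bloch a x y) * ‖T (bloch s x y)‖ := by
      rw [map_mul]; exact norm_mul_le _ _
    rw [hmul, map_smul, norm_smul, Complex.norm_real, Real.norm_eq_abs,
      abs_of_nonneg (by positivity)] at hle
    exact le_of_mul_le_mul_right hle (norm_pos_iff.mpr hne)

/-! ### Trigonometric sums over the angles `θ_b = 2π(b+1)/k` -/

/-- The angle of the outcome `b` of the planar measurement. -/
def angle (k : ℕ) (b : Fin k) : ℝ := 2 * Real.pi * ((b : ℕ) + 1 : ℝ) / k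

/-- This is the real part of a geometric sum of a `k`-th root of unity, which differs from 1 because
`0 < m < k`. -/
lemma sum_cos_mul_angle {k m : ℕ} (hm : 0 < m) (hmk : m < k) (δ : ℝ) :
    ∑ b : Fin k, Real.cos (m * angle k b + δ) = 0 := by
  have hk : (k : ℂ) ≠ 0 := by exact_mod_cast (by omega : k ≠ 0)
  set ζ : ℂ := Complex.exp (2 * Real.pi * Complex.I * (m / k)) with hζ
  have hζk : ζ ^ k = 1 := by
    rw [hζ, ← Complex.exp_nat_mul, Complex.exp_eq_one_iff]
    exact ⟨m, by push_cast; field_simp⟩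
  have hζ1 : ζ ≠ 1 := by
    rw [hζ, Ne, Complex.exp_eq_one_iff]
    rintro ⟨j, hj⟩
    have h2 : (2 * Real.pi * Complex.I : ℂ) ≠ 0 := Complex.two_pi_I_ne_zero
    have h3 : (m / k : ℂ) = j := by
      apply mul_left_cancel₀ h2; rw [hj]; ring
    rw [div_eq_iff hk] at h3
    have h4 : (m : ℤ) = j * k := by exact_mod_cast h3
    have h5 : (k : ℤ) ∣ m := ⟨j, by rw [h4]; ring⟩
    exact absurd (Nat.le_of_dvd hm (by exact_mod_cast h5)) (by omega)
  have hgeom : ∑ b : Fin k, ζ ^ (b : ℕ) = 0 := by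
    rw [Fin.sum_univ_eq_sum_range (fun i => ζ ^ i), geom_sum_eq hζ1, hζk]; simp
  have hexp : ∑ b : Fin k, Complex.exp (((m * angle k b + δ : ℝ) : ℂ) * Complex.I) = 0 := by
    have : ∀ b : Fin k, Complex.exp (((m * angle k b + δ : ℝ) : ℂ) * Complex.I) =
        (Complex.exp (δ * Complex.I) * ζ) * ζ ^ (b : ℕ) := by
      intro b
      rw [hζ, ← Complex.exp_nat_mul, ← Complex.exp_add, ← Complex.exp_add]
      congr 1
      rw [angle]; push_cast; field_simp; ring
    simp_rw [this, ← Finset.mul_sum, hgeom, mul_zero]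
  have := congrArg Complex.re hexp
  simpa only [Complex.re_sum, Complex.exp_ofReal_mul_I_re, Complex.zero_re] using this

section sums
variable {k : ℕ}

lemma sum_cos_angle_add (hk : 2 ≤ k) (δ : ℝ) : ∑ b : Fin k, Real.cos (angle k b + δ) = 0 := by
  simpa using sum_cos_mul_angle (k := k) (m := 1) one_pos (by omega) δ

lemma sum_sin_angle_add (hk : 2 ≤ k) (δ : ℝ) : ∑ b : Fin k, Real.sin (angle k b + δ) = 0 := by
  rw [← sum_cos_angle_add hk (δ - Real.pi / 2)]
  exact Finset.sum_congr rfl fun b _ => by rw [← Real.cos_sub_pi_div_two]; ring_nf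

/-- The product-to-sum formula leaves a frequency-2 term, which cancels only because `2 < k`. -/
lemma sum_cos_angle_mul_cos_angle (hk : 3 ≤ k) (δ ε : ℝ) :
    ∑ b : Fin k, Real.cos (angle k b + δ) * Real.cos (angle k b + ε) =
      k / 2 * Real.cos (δ - ε) := by
  have h : ∀ b : Fin k, Real.cos (angle k b + δ) * Real.cos (angle k b + ε) =
      1 / 2 * Real.cos ((2 : ℕ) * angle k b + (δ + ε)) + 1 / 2 * Real.cos (δ - ε) := by
    intro b
    have h1 : ((2 : ℕ) : ℝ) * angle k b + (δ + ε) = (angle k b + δ) + (angle k b + ε) := by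
      push_cast; ring
    have h2 : δ - ε = (angle k b + δ) - (angle k b + ε) := by ring
    rw [h1, h2, Real.cos_add (angle k b + δ), Real.cos_sub (angle k b + δ)]; ring
  simp_rw [h, Finset.sum_add_distrib, ← Finset.mul_sum]
  rw [sum_cos_mul_angle two_pos (by omega)]
  simp; ring

lemma sum_cos_angle_mul_sin_angle (hk : 3 ≤ k) (δ ε : ℝ) :
    ∑ b : Fin k, Real.cos (angle k b + δ) * Real.sin (angle k b + ε) =
      k / 2 * Real.sin (ε - δ) := by
  have := sum_cos_angle_mul_cos_angle hk δ (ε - Real.pi / 2)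
  rw [show δ - (ε - Real.pi / 2) = Real.pi / 2 - (ε - δ) by ring, Real.cos_pi_div_two_sub] at this
  rw [← this]
  exact Finset.sum_congr rfl fun b _ => by rw [← Real.cos_sub_pi_div_two]; ring_nf

end sums

/-! ### Geometry of the regular `k`-gon -/

section geometry
variable {k : ℕ}

lemma cos_pi_div_pos (hk : 3 ≤ k) : 0 < Real.cos (Real.pi / k) := by
  have h3 : (3 : ℝ) ≤ k := by exact_mod_cast hk
  have hpi := Real.pi_pos
  refine Real.cos_pos_of_mem_Ioo ⟨by have : 0 < Real.pi / k := by positivity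
                                     linarith, ?_⟩
  rw [div_lt_div_iff₀ (by linarith) two_pos]
  nlinarith

lemma one_lt_two_mul_cos_pi_div (hk : 4 ≤ k) : 1 < 2 * Real.cos (Real.pi / k) := by
  have h4 : (4 : ℝ) ≤ k := by exact_mod_cast hk
  have hpi := Real.pi_pos
  have h := Real.strictAntiOn_cos (a := Real.pi / k) (b := Real.pi / 3)
    ⟨by positivity, by rw [div_le_iff₀ (by linarith)]; nlinarith⟩
    ⟨by positivity, by linarith⟩ (by
      rw [div_lt_div_iff₀ (by linarith) (by norm_num)]; nlinarith)
  rw [Real.cos_pi_div_three] at h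
  linarith

/-- Among the odd multiples of `π / k`, the angle `π / k` has the largest cosine. -/
lemma cos_odd_mul_pi_div_le (hk : 0 < k) {m : ℤ} (hm : Odd m) :
    Real.cos (m * (Real.pi / k)) ≤ Real.cos (Real.pi / k) := by
  have hk' : (0 : ℝ) < k := by exact_mod_cast hk
  have base : ∀ j : ℤ, 1 ≤ j → j ≤ k →
      Real.cos (j * (Real.pi / k)) ≤ Real.cos (Real.pi / k) := by
    intro j h1 h2
    have h1' : (1 : ℝ) ≤ j := by exact_mod_cast h1
    have h2' : (j : ℝ) ≤ k := by exact_mod_cast h2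
    have hp : 0 < Real.pi / k := by positivity
    refine Real.cos_le_cos_of_nonneg_of_le_pi hp.le ?_ (by nlinarith)
    calc (j : ℝ) * (Real.pi / k) ≤ k * (Real.pi / k) := by gcongr
      _ = Real.pi := by field_simp
  obtain ⟨a, ha⟩ := hm
  set q := m / (2 * k : ℤ)
  set r := m % (2 * k : ℤ)
  have hdiv : 2 * (k : ℤ) * q + r = m := Int.mul_ediv_add_emod m (2 * k)
  have hr0 : 0 ≤ r := Int.emod_nonneg _ (by omega)
  have hr1 : r < 2 * k := Int.emod_lt_of_pos _ (by omega)
  have hrodd : r ≠ 0 := by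
    intro h0
    rw [h0, ha] at hdiv
    have : 2 * ((k : ℤ) * q - a) = 1 := by linarith
    omega
  have hmr : Real.cos (m * (Real.pi / k)) = Real.cos (r * (Real.pi / k)) := by
    rw [← Real.cos_add_int_mul_two_pi (r * (Real.pi / k)) q, ← hdiv]
    congr 1; push_cast; field_simp; ring
  rw [hmr]
  rcases le_or_gt r k with h | h
  · exact base r (by omega) h
  -- The reflection `r ↦ 2k - r` preserves the cosine and brings the multiple into `[1, k]`.
  · have := base (2 * k - r) (by omega) (by omega)
    rwa [show (((2 * k - r : ℤ)) : ℝ) * (Real.pi / k) = 2 * Real.pi - r * (Real.pi / k) by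
      push_cast; field_simp, Real.cos_two_pi_sub] at this

/-- Every direction is within `π / k` of one of the angles `θ_b`. -/
lemma exists_cos_angle_sub_ge (hk : 0 < k) (φ : ℝ) :
    ∃ b : Fin k, Real.cos (Real.pi / k) ≤ Real.cos (angle k b - φ) := by
  have hk' : (0 : ℝ) < k := by exact_mod_cast hk
  have hpi := Real.pi_pos
  set t : ℝ := φ * k / (2 * Real.pi) with ht
  set j : ℤ := round t with hj
  have hjt : |t - j| ≤ 1 / 2 := abs_sub_round t
  -- The nearest grid angle is `2πj/k`. The shift by one appears because index `i` stands for
  -- outcome `i + 1`.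
  set q := (j - 1) / (k : ℤ)
  set r := (j - 1) % (k : ℤ) with hr
  have hdiv : (k : ℤ) * q + r = j - 1 := Int.mul_ediv_add_emod (j - 1) k
  have hr0 : 0 ≤ r := Int.emod_nonneg _ (by omega)
  have hr1 : r < k := Int.emod_lt_of_pos _ (by omega)
  refine ⟨⟨r.toNat, by omega⟩, ?_⟩
  have hrn : ((r.toNat : ℕ) : ℝ) = r := by
    have : ((r.toNat : ℕ) : ℤ) = r := Int.toNat_of_nonneg hr0
    exact_mod_cast this
  have hang : Real.cos (angle k ⟨r.toNat, by omega⟩ - φ) =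
      Real.cos (|t - j| * (2 * Real.pi / k)) := by
    have hjr : (j : ℝ) = k * q + r + 1 := by
      have : j = k * q + r + 1 := by omega
      exact_mod_cast this
    have hφ : φ = t * (2 * Real.pi / k) := by rw [ht]; field_simp
    have h1 : angle k ⟨r.toNat, by omega⟩ - φ =
        (-((t - j) * (2 * Real.pi / k))) - q * (2 * Real.pi) := by
      rw [angle, hrn, hjr]; conv_lhs => rw [hφ]
      field_simp; ring
    have hpos : 0 ≤ 2 * Real.pi / k := by positivity
    rw [h1, Real.cos_sub_int_mul_two_pi, Real.cos_neg, ← Real.cos_abs, abs_mul,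
      abs_of_nonneg hpos]
  rw [hang]
  have hpk : Real.pi / k ≤ Real.pi :=
    div_le_self hpi.le (by exact_mod_cast (by omega : 1 ≤ k))
  refine Real.cos_le_cos_of_nonneg_of_le_pi (by positivity) hpk ?_
  calc |t - j| * (2 * Real.pi / k) ≤ 1 / 2 * (2 * Real.pi / k) := by gcongr
    _ = Real.pi / k := by ring

/-- The regular polygon cut out by the tangents at the angles `θ_b + π` has circumradius
`1 / cos (π / k)`. -/
lemma polygon_radius (hk : 3 ≤ k) {x y : ℝ}
    (h : ∀ b : Fin k, 0 ≤ 1 + (x * Real.cos (angle k b) + y * Real.sin (angle k b))) :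
    x ^ 2 + y ^ 2 ≤ (1 / Real.cos (Real.pi / k)) ^ 2 := by
  -- The binding constraint is the one whose angle is nearest to the direction opposite to `(x, y)`.
  set z : ℂ := ⟨-x, -y⟩ with hz
  have hx : x = -(‖z‖ * Real.cos z.arg) := by rw [Complex.norm_mul_cos_arg]; simp [hz]
  have hy : y = -(‖z‖ * Real.sin z.arg) := by rw [Complex.norm_mul_sin_arg]; simp [hz]
  obtain ⟨b, hb⟩ := exists_cos_angle_sub_ge (k := k) (by omega) z.arg
  have hc := cos_pi_div_pos hk
  have h1 : ‖z‖ * Real.cos (angle k b - z.arg) ≤ 1 := by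
    have := h b
    rw [hx, hy] at this
    rw [Real.cos_sub]; linarith
  have h2 : ‖z‖ ≤ 1 / Real.cos (Real.pi / k) := by
    rw [le_div_iff₀ hc]
    exact (mul_le_mul_of_nonneg_left hb (norm_nonneg z)).trans h1
  have h3 : x ^ 2 + y ^ 2 = ‖z‖ ^ 2 := by
    rw [← Complex.normSq_eq_norm_sq, Complex.normSq_apply, hz]; ring
  rw [h3]
  exact pow_le_pow_left₀ (norm_nonneg z) h2 2

end geometry

/-! ### The planar measurement and its assignment polytope -/

section planar
variable {k : ℕ}

lemma planarEffect_eq (k : ℕ) (θ : ℝ) :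
    planarEffect k θ = bloch (1 / k) (1 / k * Real.cos θ) (1 / k * Real.sin θ) := by
  have : planarEffect k θ = (1 / (k : ℝ)) • bloch 1 (Real.cos θ) (Real.sin θ) := by
    rw [planarEffect, bloch, one_smul]
  rw [this, smul_bloch, mul_one]

lemma planar_eq (k : ℕ) (b : Fin k) :
    planar k b =
      bloch (1 / k) (1 / k * Real.cos (angle k b)) (1 / k * Real.sin (angle k b)) :=
  planarEffect_eq k _

lemma noisy_planar_eq (k : ℕ) (η : ℝ) (b : Fin k) :
    noisy (planar k) η b =
      bloch (1 / k) (η * (1 / k * Real.cos (angle k b))) (η * (1 / k * Real.sin (angle k b))) := by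
  have h : ((planar k b).trace / (Fintype.card (Fin 2) : ℂ)) = ((1 / k : ℝ) : ℂ) := by
    rw [planar_eq, bloch_trace]; push_cast; simp
  rw [noisy, h, planar_eq, ← Complex.ofReal_mul, Complex.coe_smul, Complex.coe_smul, ← bloch_one,
    smul_bloch, smul_bloch, bloch_add, bloch_inj]
  refine ⟨?_, ?_, ?_⟩ <;> ring

lemma noisy_one {B n : Type} [Fintype n] [DecidableEq n] (M : B → Matrix n n ℂ) :
    noisy M 1 = M := by
  funext b; simp [noisy]

lemma isPOVM_planarEffect (hk : 2 ≤ k) (δ : ℝ) :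
    IsPOVM fun b : Fin k => planarEffect k (angle k b + δ) := by
  have hk' : (k : ℝ) ≠ 0 := by exact_mod_cast (by omega : k ≠ 0)
  refine ⟨fun b => ?_, ?_⟩
  · simp only [planarEffect_eq]
    refine bloch_posSemidef (by positivity) (le_of_eq ?_)
    linear_combination (1 / k : ℝ) ^ 2 * Real.cos_sq_add_sin_sq (angle k b + δ)
  · simp only [planarEffect_eq, sum_bloch, ← Finset.mul_sum, sum_cos_angle_add hk,
      sum_sin_angle_add hk, ← bloch_one, bloch_inj]
    simp [hk']

lemma isPOVM_planar (hk : 2 ≤ k) : IsPOVM (planar k) := by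
  have := isPOVM_planarEffect hk 0
  simp only [add_zero] at this
  exact this

/-- The shift of the angles of the parent measurement. -/
def parentShift (k : ℕ) : ℝ := if Even k then Real.pi / k else 0

lemma planarParent_eq (k : ℕ) (l : Fin k) :
    planarParent k l = planarEffect k (angle k l + parentShift k) := by
  unfold planarParent parentShift angle
  split_ifs
  · rw [add_div]
  · rw [add_zero]

lemma isPOVM_planarParent (hk : 2 ≤ k) : IsPOVM (planarParent k) := by
  rw [funext (planarParent_eq k)]
  exact isPOVM_planarEffect hk _

lemma sum_smul_noisy_planar_eq_zero {η : ℝ} {β : Fin k → ℝ} (hk : 0 < k) :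
    ∑ b, β b • noisy (planar k) η b = 0 ↔
      ∑ b, β b = 0 ∧ η * ∑ b, β b * Real.cos (angle k b) = 0 ∧
        η * ∑ b, β b * Real.sin (angle k b) = 0 := by
  have hk' : (1 / k : ℝ) ≠ 0 := by
    have : (k : ℝ) ≠ 0 := by exact_mod_cast hk.ne'
    positivity
  have h : ∀ f : Fin k → ℝ, ∑ b, β b * (η * (1 / k * f b)) = 1 / k * (η * ∑ b, β b * f b) := by
    intro f
    rw [Finset.mul_sum, Finset.mul_sum]
    exact Finset.sum_congr rfl fun b _ => by ring
  simp only [noisy_planar_eq, smul_bloch, sum_bloch, bloch_eq_zero, h, ← Finset.sum_mul,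
    mul_eq_zero_iff_left hk', mul_eq_zero_iff_right hk']

/-- Noise preserves every relation among the effects. Only an inclusion is claimed, since at `η = 0`
new relations appear. -/
lemma assignmentPolytope_noisy_subset (hk : 0 < k) (η : ℝ) :
    assignmentPolytope (noisy (planar k) η) ⊆ assignmentPolytope (planar k) := by
  rintro p ⟨h0, h1, h2⟩
  refine ⟨h0, h1, fun β hβ => h2 β ?_⟩
  rw [← noisy_one (planar k), sum_smul_noisy_planar_eq_zero hk] at hβ
  rw [sum_smul_noisy_planar_eq_zero hk]
  simp only [one_mul] at hβ
  simp [hβ.1, hβ.2.1, hβ.2.2]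

/-- The amplitude carries the factor `η` so that the claim survives at `η = 0`, where only the
uniform assignment remains. -/
lemma mem_assignmentPolytope_noisy (hk : 2 ≤ k) {η u δ : ℝ}
    (h : ∀ b, 0 ≤ 1 + η * (u * Real.cos (angle k b - δ))) :
    (fun b => 1 / k * (1 + η * (u * Real.cos (angle k b - δ)))) ∈
      assignmentPolytope (noisy (planar k) η) := by
  have hk' : (k : ℝ) ≠ 0 := by exact_mod_cast (by omega : k ≠ 0)
  refine ⟨fun b => mul_nonneg (by positivity) (h b), ?_, fun β hβ => ?_⟩
  · simp only [← Finset.mul_sum, Finset.sum_add_distrib, sub_eq_add_neg, sum_cos_angle_add hk]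
    simp [hk']
  · rw [sum_smul_noisy_planar_eq_zero (by omega)] at hβ
    obtain ⟨h1, h2, h3⟩ := hβ
    have : ∀ b, β b * (1 / k * (1 + η * (u * Real.cos (angle k b - δ)))) =
        1 / k * β b + (1 / k * u * Real.cos δ * η) * (β b * Real.cos (angle k b)) +
          (1 / k * u * Real.sin δ * η) * (β b * Real.sin (angle k b)) := by
      intro b; rw [Real.cos_sub]; ring
    simp only [this, Finset.sum_add_distrib, ← Finset.mul_sum]
    rw [h1, mul_assoc _ η, h2, mul_assoc _ η, h3]; ring

/-- The points of the assignment polytope are the affine functions of the direction. -/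
lemma assignment_eq (hk : 3 ≤ k) {p : Fin k → ℝ} (hp : p ∈ assignmentPolytope (planar k))
    (b : Fin k) :
    p b = 1 / k * (1 + ((2 * ∑ a, p a * Real.cos (angle k a)) * Real.cos (angle k b) +
      (2 * ∑ a, p a * Real.sin (angle k a)) * Real.sin (angle k b))) := by
  have hk' : (k : ℝ) ≠ 0 := by exact_mod_cast (by omega : k ≠ 0)
  obtain ⟨-, h1, h2⟩ := hp
  -- `(1 + 2 cos (θ_a - θ_b))/k` is the kernel of the orthogonal projection onto the span of `1,
  -- cos, sin`. Subtracting it from the point mass at `b` gives a relation among the effects.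
  set β : Fin k → ℝ := fun a =>
    (if a = b then 1 else 0) - 1 / k * (1 + 2 * Real.cos (angle k a + -angle k b)) with hβ
  have hsplit : ∀ f : Fin k → ℝ, ∑ a, β a * f a =
      f b - 1 / k * (∑ a, f a + 2 * ∑ a, Real.cos (angle k a + -angle k b) * f a) := by
    intro f
    simp only [hβ, sub_mul, Finset.sum_sub_distrib, ite_mul, one_mul, zero_mul,
      Finset.sum_ite_eq', Finset.mem_univ, if_true, Finset.mul_sum, ← Finset.sum_add_distrib]
    congr 1
    exact Finset.sum_congr rfl fun a _ => by ring
  have hβ0 : ∑ a, β a • planar k a = 0 := by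
    have e1 := sum_cos_angle_mul_cos_angle hk (-angle k b) 0
    have e2 := sum_cos_angle_mul_sin_angle hk (-angle k b) 0
    have e3 := sum_cos_angle_add (k := k) (by omega) 0
    have e4 := sum_sin_angle_add (k := k) (by omega) 0
    have e5 := sum_cos_angle_add (k := k) (by omega) (-angle k b)
    simp only [add_zero, sub_zero, zero_sub, neg_neg, Real.cos_neg] at e1 e2 e3 e4
    rw [← noisy_one (planar k), sum_smul_noisy_planar_eq_zero (by omega)]
    refine ⟨?_, ?_, ?_⟩
    · have := hsplit fun _ => 1
      simp only [mul_one] at this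
      rw [this, e5]; simp [hk']
    · rw [hsplit, e1, e3]; field_simp; ring
    · rw [hsplit, e2, e4]; field_simp; ring
  have h := h2 β hβ0
  rw [hsplit, h1] at h
  have e : ∑ a, Real.cos (angle k a + -angle k b) * p a =
      (∑ a, p a * Real.cos (angle k a)) * Real.cos (angle k b) +
        (∑ a, p a * Real.sin (angle k a)) * Real.sin (angle k b) := by
    rw [Finset.sum_mul, Finset.sum_mul, ← Finset.sum_add_distrib]
    exact Finset.sum_congr rfl fun a _ => by rw [← sub_eq_add_neg, Real.cos_sub]; ring
  rw [e] at h
  linear_combination h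

lemma assignment_radius (hk : 3 ≤ k) {p : Fin k → ℝ}
    (hp : p ∈ assignmentPolytope (planar k)) :
    (2 * ∑ a, p a * Real.cos (angle k a)) ^ 2 + (2 * ∑ a, p a * Real.sin (angle k a)) ^ 2 ≤
      (1 / Real.cos (Real.pi / k)) ^ 2 := by
  have hk' : (0 : ℝ) < k := by exact_mod_cast (by omega : 0 < k)
  refine polygon_radius hk fun b => ?_
  have h := hp.1 b
  rw [assignment_eq hk hp b] at h
  exact nonneg_of_mul_nonneg_right h (by positivity)

/-- The vertices of the assignment polytope. -/
def planarVertex (k : ℕ) (l b : Fin k) : ℝ :=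
  1 / k * (1 + 1 / Real.cos (Real.pi / k) *
    Real.cos (angle k b - (angle k l + parentShift k)))

/-- The angle difference is `π` plus an odd multiple of `π/k`. The shift in `parentShift` is there
to secure this parity when `k` is even. -/
lemma neg_cos_pi_div_le_cos (hk : 0 < k) (l b : Fin k) :
    -Real.cos (Real.pi / k) ≤ Real.cos (angle k b - (angle k l + parentShift k)) := by
  have hk' : (k : ℝ) ≠ 0 := by exact_mod_cast hk.ne'
  suffices h : ∃ m : ℤ, Odd m ∧
      angle k b - (angle k l + parentShift k) = m * (Real.pi / k) + Real.pi by
    obtain ⟨m, hm, h⟩ := h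
    rw [h, Real.cos_add_pi]
    exact neg_le_neg (cos_odd_mul_pi_div_le hk hm)
  by_cases he : Even k
  · refine ⟨2 * (b - l) - 1 - k, ?_, ?_⟩
    · obtain ⟨c, hc⟩ := he
      exact ⟨b - l - 1 - c, by omega⟩
    · rw [angle, angle, parentShift, if_pos he]; push_cast; field_simp; ring
  · refine ⟨2 * (b - l) - k, ?_, ?_⟩
    · obtain ⟨c, hc⟩ := Nat.not_even_iff_odd.mp he
      exact ⟨b - l - 1 - c, by omega⟩
    · rw [angle, angle, parentShift, if_neg he]; push_cast; field_simp; ring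

lemma planarVertex_moments (hk : 3 ≤ k) (l : Fin k) :
    (2 * ∑ b, planarVertex k l b * Real.cos (angle k b) =
      1 / Real.cos (Real.pi / k) * Real.cos (angle k l + parentShift k)) ∧
    (2 * ∑ b, planarVertex k l b * Real.sin (angle k b) =
      1 / Real.cos (Real.pi / k) * Real.sin (angle k l + parentShift k)) := by
  have hk' : (k : ℝ) ≠ 0 := by exact_mod_cast (by omega : k ≠ 0)
  set φ := angle k l + parentShift k with hφ
  have e1 := sum_cos_angle_mul_cos_angle hk (-φ) 0
  have e2 := sum_cos_angle_mul_sin_angle hk (-φ) 0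
  have e3 := sum_cos_angle_add (k := k) (by omega) 0
  have e4 := sum_sin_angle_add (k := k) (by omega) 0
  simp only [add_zero, sub_zero, zero_sub, neg_neg, Real.cos_neg] at e1 e2 e3 e4
  have hsplit : ∀ f : Fin k → ℝ, ∑ b, planarVertex k l b * f b =
      1 / k * (∑ b, f b + 1 / Real.cos (Real.pi / k) *
        ∑ b, Real.cos (angle k b + -φ) * f b) := by
    intro f
    simp only [Finset.mul_sum, ← Finset.sum_add_distrib, planarVertex, ← hφ, sub_eq_add_neg]
    exact Finset.sum_congr rfl fun b _ => by ring
  constructor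
  · rw [hsplit, e1, e3]; field_simp; ring
  · rw [hsplit, e2, e4]; field_simp; ring

lemma planarVertex_mem (hk : 3 ≤ k) (l : Fin k) :
    planarVertex k l ∈ assignmentPolytope (planar k) := by
  have hc := cos_pi_div_pos hk
  have h := mem_assignmentPolytope_noisy (k := k) (by omega) (η := 1)
    (u := 1 / Real.cos (Real.pi / k)) (δ := angle k l + parentShift k) (fun b => by
      have := neg_cos_pi_div_le_cos (by omega) l b
      have h2 : -1 ≤ 1 / Real.cos (Real.pi / k) *
          Real.cos (angle k b - (angle k l + parentShift k)) := by
        rw [one_div_mul_eq_div, le_div_iff₀ hc]; linarith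
      linarith)
  rw [noisy_one] at h
  simp only [one_mul] at h
  exact h

/-- Its moment vector lies on the circle that bounds the whole polytope. Discs are strictly convex,
so any two assignments mixing to it have equal moments and hence coincide. -/
lemma planarVertex_mem_vertexAssignments (hk : 3 ≤ k) (l : Fin k) :
    planarVertex k l ∈ vertexAssignments (planar k) := by
  rw [vertexAssignments, mem_extremePoints]
  refine ⟨planarVertex_mem hk l, fun p hp q hq hpq => ?_⟩
  obtain ⟨s, t, hs, ht, hst, hV⟩ := hpq
  obtain ⟨m1, m2⟩ := planarVertex_moments hk l
  have rp := assignment_radius hk hp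
  have rq := assignment_radius hk hq
  have lin : ∀ f : Fin k → ℝ, 2 * ∑ b, planarVertex k l b * f b =
      s * (2 * ∑ b, p b * f b) + t * (2 * ∑ b, q b * f b) := by
    intro f
    simp only [← hV, Finset.mul_sum, ← Finset.sum_add_distrib, Pi.add_apply, Pi.smul_apply,
      smul_eq_mul]
    exact Finset.sum_congr rfl fun b _ => by ring
  have c1 := lin fun b => Real.cos (angle k b)
  have c2 := lin fun b => Real.sin (angle k b)
  have hp' := assignment_eq hk hp
  have hq' := assignment_eq hk hq
  have hv' := assignment_eq hk (planarVertex_mem hk l)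
  set R := 1 / Real.cos (Real.pi / k)
  set xp := 2 * ∑ a, p a * Real.cos (angle k a)
  set yp := 2 * ∑ a, p a * Real.sin (angle k a)
  set xq := 2 * ∑ a, q a * Real.cos (angle k a)
  set yq := 2 * ∑ a, q a * Real.sin (angle k a)
  have hsq : (s * xp + t * xq) ^ 2 + (s * yp + t * yq) ^ 2 = R ^ 2 := by
    rw [← c1, ← c2, m1, m2]
    linear_combination R ^ 2 * Real.cos_sq_add_sin_sq (angle k l + parentShift k)
  have hd : s * t * ((xp - xq) ^ 2 + (yp - yq) ^ 2) ≤ 0 := by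
    have ht' : t = 1 - s := by linarith
    have : s * t * ((xp - xq) ^ 2 + (yp - yq) ^ 2) =
        s * (xp ^ 2 + yp ^ 2) + t * (xq ^ 2 + yq ^ 2) -
          ((s * xp + t * xq) ^ 2 + (s * yp + t * yq) ^ 2) := by rw [ht']; ring
    rw [this, hsq]
    have h1 := mul_le_mul_of_nonneg_left rp hs.le
    have h2 := mul_le_mul_of_nonneg_left rq ht.le
    have h3 : s * R ^ 2 + t * R ^ 2 = R ^ 2 := by rw [← add_mul, hst, one_mul]
    linarith
  have hd' : (xp - xq) ^ 2 + (yp - yq) ^ 2 ≤ 0 :=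
    nonpos_of_mul_nonpos_right hd (mul_pos hs ht)
  have hx : xp = xq := by nlinarith [sq_nonneg (xp - xq), sq_nonneg (yp - yq)]
  have hy : yp = yq := by nlinarith [sq_nonneg (xp - xq), sq_nonneg (yp - yq)]
  have hpq : p = q := by
    funext b; rw [hp' b, hq' b, hx, hy]
  have hpv : p = planarVertex k l := by
    rw [← hV, ← hpq, ← add_smul, hst, one_smul]
  exact ⟨hpv, hpq ▸ hpv⟩

/-- Mixing the vertices with white noise and measuring the parent POVM simulates the noisy planar
measurement. -/
lemma sum_smul_planarParent (hk : 3 ≤ k) (η : ℝ) (b : Fin k) :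
    ∑ l, (1 / k * (1 + η * (2 * Real.cos (angle k b - (angle k l + parentShift k))))) •
      planarParent k l = noisy (planar k) η b := by
  have hk' : (k : ℝ) ≠ 0 := by exact_mod_cast (by omega : k ≠ 0)
  set σ := parentShift k with hσ
  have e1 := sum_cos_angle_mul_cos_angle hk (σ - angle k b) σ
  have e2 := sum_cos_angle_mul_sin_angle hk (σ - angle k b) σ
  have e3 := sum_cos_angle_add (k := k) (by omega) σ
  have e4 := sum_sin_angle_add (k := k) (by omega) σ
  have e5 := sum_cos_angle_add (k := k) (by omega) (σ - angle k b)
  rw [show σ - angle k b - σ = -angle k b by ring, Real.cos_neg] at e1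
  rw [show σ - (σ - angle k b) = angle k b by ring] at e2
  have hcos : ∀ l, Real.cos (angle k b - (angle k l + σ)) =
      Real.cos (angle k l + (σ - angle k b)) := by
    intro l; rw [← Real.cos_neg]; congr 1; ring
  have hsplit : ∀ f : Fin k → ℝ,
      ∑ l, (1 / k * (1 + η * (2 * Real.cos (angle k l + (σ - angle k b))))) * (1 / k * f l) =
      1 / k * (1 / k) * (∑ l, f l + 2 * η * ∑ l, Real.cos (angle k l + (σ - angle k b)) * f l) := by
    intro f
    simp only [Finset.mul_sum, ← Finset.sum_add_distrib]
    exact Finset.sum_congr rfl fun b _ => by ring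
  simp only [planarParent_eq, planarEffect_eq, ← hσ, smul_bloch, sum_bloch, hcos]
  rw [noisy_planar_eq, bloch_inj, hsplit, hsplit, e1, e2, e3, e4]
  refine ⟨?_, by field_simp; ring, by field_simp; ring⟩
  have := hsplit fun _ => 1
  simp only [mul_one] at this
  rw [this, e5]; simp; field_simp

end planar

/-! ### Classicality from and to simulations -/

section models
variable {n : Type} [Fintype n]

/-- The parent outcomes serve as ontic states. Their Born probabilities are linear in the state, so
preparation identities are automatic. -/
lemma isClassical_of_simulation [DecidableEq n] {B L : Type} [Fintype B] [Fintype L] {N : B → Matrix n n ℂ}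
    {G : L → Matrix n n ℂ} {D : L → B → ℝ} (hG : IsPOVM G)
    (hD : ∀ l, D l ∈ assignmentPolytope N) (h : ∀ b, ∑ l, D l b • G l = N b) :
    IsClassical N := by
  refine ⟨L, ⟨{
    prep := fun ρ _ l => (G l * ρ.1).trace.re
    resp := fun _ l b => D l b
    prep_nonneg := fun ρ _ l => trace_mul_re_nonneg (hG.1 l) ρ.2.1
    prep_hasSum := fun ρ a => ?_
    resp_nonneg := fun _ l b => (hD l).1 b
    resp_sum := fun _ l => (hD l).2.1
    reproduces := fun ρ a _ b => ?_
    resp_identities := fun β hβ l => ?_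
    prep_identities := fun α hα l => ?_ }⟩⟩
  · have : (allStates n ρ a).trace.re = ∑ l, (G l * ρ.1).trace.re := by
      rw [← Complex.re_sum, ← Matrix.trace_sum, ← Finset.sum_mul, hG.2, one_mul]; rfl
    rw [this]
    exact hasSum_fintype _
  · have : (N b * allStates n ρ a).trace.re = ∑ l, D l b * (G l * ρ.1).trace.re := by
      rw [← h b, Finset.sum_mul, Matrix.trace_sum, Complex.re_sum]
      refine Finset.sum_congr rfl fun l _ => ?_
      rw [Matrix.smul_mul, Matrix.trace_smul, Complex.smul_re, smul_eq_mul]; rfl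
    rw [this]
    exact hasSum_fintype _
  · rw [Finsupp.sum_fintype _ _ (by simp), Fintype.sum_prod_type] at hβ ⊢
    simp only [Finset.univ_unique, Finset.sum_singleton] at hβ ⊢
    exact (hD l).2.2 _ hβ
  · have h1 := congrArg (fun A => (G l * A).trace.re) hα
    simp only [Finsupp.sum, Finset.mul_sum, Matrix.trace_sum, Complex.re_sum, Matrix.mul_smul,
      Matrix.trace_smul, Complex.smul_re, smul_eq_mul, mul_zero, Matrix.trace_zero,
      Complex.zero_re] at h1
    exact h1

variable {B Λ : Type} [Fintype B] {N : B → Matrix n n ℂ}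

lemma OntologicalModel.resp_mem_assignmentPolytope
    (m : OntologicalModel (allStates n) (fun _ : Unit => N) Λ) (l : Λ) :
    m.resp () l ∈ assignmentPolytope N := by
  refine ⟨m.resp_nonneg () l, m.resp_sum () l, fun β hβ => ?_⟩
  have h := m.resp_identities (Finsupp.equivFunOnFinite.symm fun yb => β yb.2)
  simp only [Finsupp.sum_fintype, zero_smul, zero_mul, implies_true,
    Finsupp.equivFunOnFinite_symm_apply_apply, Fintype.sum_prod_type, Finset.univ_unique,
    Finset.sum_singleton] at h
  exact h hβ l

/-- The family `x` need not be injective: `mapDomain` adds the coefficients of coinciding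
preparations, so possible coincidences among chosen states need no case split. -/
lemma OntologicalModel.prep_identity {X A Y : Type} {P : X → A → Matrix n n ℂ}
    {M : Y → B → Matrix n n ℂ} (m : OntologicalModel P M Λ) {J : Type} [Fintype J]
    (x : J → X × A) (α : J → ℝ) (h : ∑ j, α j • P (x j).1 (x j).2 = 0) (l : Λ) :
    ∑ j, α j * m.prep (x j).1 (x j).2 l = 0 := by
  have key := m.prep_identities
    (Finsupp.mapDomain x (Finsupp.equivFunOnFinite.symm α)) ?_ l
  · rwa [Finsupp.sum_mapDomain_index (by simp) (by intros; ring),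
      Finsupp.sum_fintype _ _ (by simp)] at key
  · rw [Finsupp.sum_mapDomain_index (by simp) (by intros; rw [add_smul]),
      Finsupp.sum_fintype _ _ (by simp)]
    exact h

end models

/-! ### The critical noise level, and the cases `k = 2, 3` -/

section planar
variable {k : ℕ}

/-- The qubit state with Bloch vector `(x, y)` in the `σ_x`-`σ_z` plane. -/
def blochState (x y : ℝ) (h : x ^ 2 + y ^ 2 ≤ 1) : QState (Fin 2) :=
  ⟨bloch (1 / 2) (1 / 2 * x) (1 / 2 * y), bloch_posSemidef (by norm_num) (by linarith), by
    rw [bloch_trace]; norm_num⟩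

lemma isClassical_noisy_planar (hk : 3 ≤ k) {η : ℝ} (h0 : 0 ≤ η)
    (h1 : η ≤ 1 / (2 * Real.cos (Real.pi / k))) : IsClassical (noisy (planar k) η) := by
  have hc := cos_pi_div_pos hk
  refine isClassical_of_simulation (isPOVM_planarParent (k := k) (by omega)) (fun l =>
    mem_assignmentPolytope_noisy (by omega) fun b => ?_) (sum_smul_planarParent hk η)
  rw [le_div_iff₀ (by positivity)] at h1
  have h2 := neg_cos_pi_div_le_cos (by omega) l b
  nlinarith

lemma le_of_isClassical_noisy_planar (hk : 4 ≤ k) {η : ℝ}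
    (h : IsClassical (noisy (planar k) η)) : η ≤ 1 / (2 * Real.cos (Real.pi / k)) := by
  obtain ⟨Λ, ⟨m⟩⟩ := h
  have hk' : (k : ℝ) ≠ 0 := by exact_mod_cast (by omega : k ≠ 0)
  have hc := cos_pi_div_pos (k := k) (by omega)
  set κ := 1 / (2 * Real.cos (Real.pi / k)) with hκ
  have hκ0 : 0 < κ := by positivity
  have hR : (1 / Real.cos (Real.pi / k)) ^ 2 = (2 * κ) ^ 2 := by rw [hκ]; field_simp
  let ρ : Fin k → QState (Fin 2) := fun b =>
    blochState (Real.cos (angle k b)) (Real.sin (angle k b)) (Real.cos_sq_add_sin_sq _).le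
  let μ : QState (Fin 2) := blochState 0 0 (by norm_num)
  have hle : ∀ l, ∑ b, m.resp () l b * m.prep (ρ b) () l ≤ (1 + κ) * m.prep μ () l := by
    intro l
    have hp := assignmentPolytope_noisy_subset (by omega) η (m.resp_mem_assignmentPolytope l)
    have hrad := assignment_radius (by omega) hp
    rw [hR] at hrad
    set p := m.resp () l
    set u := ∑ a, p a * Real.cos (angle k a) with hu
    set w := ∑ a, p a * Real.sin (angle k a) with hw
    let τ : QState (Fin 2) := blochState (-(u / κ)) (-(w / κ)) (by
      have : (-(u / κ)) ^ 2 + (-(w / κ)) ^ 2 = ((2 * u) ^ 2 + (2 * w) ^ 2) / (2 * κ) ^ 2 := by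
        field_simp
      rw [this, div_le_one (by positivity)]
      exact hrad)
    -- The identity is `(1 + κ) μ = κ τ + ∑ p_b ρ_b`: the Bloch vectors of `κ τ` and of the mixture
    -- cancel. The `τ` term is nonnegative and is then dropped.
    have hid := m.prep_identity (J := Option (Option (Fin k)))
      (fun j => (j.elim μ fun i => i.elim τ ρ, ()))
      (fun j => j.elim (-(1 + κ)) fun i => i.elim κ p) (by
        simp only [Fintype.sum_option, Option.elim, allStates, ρ, μ, τ, blochState, smul_bloch,
          sum_bloch, bloch_add, bloch_eq_zero, ← Finset.sum_mul, hp.2.1]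
        have e : ∀ f : Fin k → ℝ, ∑ b, p b * (1 / 2 * f b) = 1 / 2 * ∑ b, p b * f b := by
          intro f; rw [Finset.mul_sum]; exact Finset.sum_congr rfl fun b _ => by ring
        rw [e, e, ← hu, ← hw]
        refine ⟨by ring, ?_, ?_⟩ <;> field_simp <;> ring) l
    simp only [Fintype.sum_option, Option.elim] at hid
    have := mul_nonneg hκ0.le (m.prep_nonneg τ () l)
    linarith
  have hL : HasSum (fun l => ∑ b, m.resp () l b * m.prep (ρ b) () l) (1 + η) := by
    have := hasSum_sum (s := Finset.univ) fun (b : Fin k) _ => m.reproduces (ρ b) () () b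
    convert this using 1
    have e : ∀ b, (noisy (planar k) η b * allStates (Fin 2) (ρ b) ()).trace.re =
        1 / k * (1 + η) := by
      intro b
      simp only [allStates, ρ, blochState, noisy_planar_eq, bloch_mul_trace, Complex.ofReal_re]
      linear_combination (1 / k * η) * Real.cos_sq_add_sin_sq (angle k b)
    rw [Finset.sum_congr rfl fun b _ => e b]
    simp; field_simp
  have hU : HasSum (fun l => (1 + κ) * m.prep μ () l) (1 + κ) := by
    have := (m.prep_hasSum μ ()).mul_left (1 + κ)
    simpa [allStates, μ.2.2] using this
  linarith [hasSum_le hle hL hU]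

lemma isClassical_noisy_planar_iff (hk : 4 ≤ k) {η : ℝ} (h0 : 0 ≤ η) :
    IsClassical (noisy (planar k) η) ↔ η ≤ 1 / (2 * Real.cos (Real.pi / k)) :=
  ⟨le_of_isClassical_noisy_planar hk, isClassical_noisy_planar (by omega) h0⟩

lemma critical_mem_Icc (hk : 4 ≤ k) : 1 / (2 * Real.cos (Real.pi / k)) ∈ Set.Icc (0 : ℝ) 1 := by
  have h := one_lt_two_mul_cos_pi_div hk
  exact ⟨by positivity, by rw [div_le_one (by linarith)]; exact h.le⟩

lemma whiteNoiseRobustness_planar (hk : 4 ≤ k) :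
    whiteNoiseRobustness (planar k) = 1 / (2 * Real.cos (Real.pi / k)) := by
  obtain ⟨h0, h1⟩ := critical_mem_Icc hk
  refine IsGreatest.csSup_eq ⟨⟨⟨h0, h1⟩, isClassical_noisy_planar (by omega) h0 le_rfl⟩, ?_⟩
  exact fun η hη => le_of_isClassical_noisy_planar hk hη.2

lemma whiteNoiseRobustness_eq_one {n B : Type} [Fintype n] [DecidableEq n] [Fintype B]
    {M : B → Matrix n n ℂ} (h : IsClassical M) : whiteNoiseRobustness M = 1 :=
  IsGreatest.csSup_eq ⟨⟨⟨zero_le_one, le_rfl⟩, by rwa [noisy_one]⟩, fun _ hη => hη.1.2⟩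

/-- A POVM with linearly independent effects is classical. -/
lemma isClassical_of_linearIndependent {n B : Type} [Fintype n] [DecidableEq n] [Fintype B]
    {M : B → Matrix n n ℂ} (hM : IsPOVM M)
    (hli : ∀ β : B → ℝ, ∑ b, β b • M b = 0 → ∀ b, β b = 0) : IsClassical M := by
  classical
  refine isClassical_of_simulation (D := fun l b => if l = b then 1 else 0) hM
    (fun l => ⟨fun b => ?_, by simp, fun β hβ => by simp [hli β hβ]⟩) (fun b => by simp)
  dsimp only
  split_ifs <;> norm_num

lemma isClassical_planar_two : IsClassical (planar 2) := by
  refine isClassical_of_linearIndependent (isPOVM_planar le_rfl) fun β hβ => ?_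
  rw [← noisy_one (planar 2), sum_smul_noisy_planar_eq_zero two_pos] at hβ
  obtain ⟨h1, h2, -⟩ := hβ
  have c0 : Real.cos (angle 2 0) = -1 := by
    rw [← Real.cos_pi]; congr 1; simp [angle]
  have c1 : Real.cos (angle 2 1) = 1 := by
    rw [← Real.cos_two_pi]; congr 1; simp [angle]; ring
  simp only [Fin.sum_univ_two, c0, c1] at h1 h2
  rw [Fin.forall_fin_two]
  constructor <;> linarith

lemma isClassical_planar_three : IsClassical (planar 3) := by
  refine isClassical_of_linearIndependent (isPOVM_planar (by norm_num)) fun β hβ => ?_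
  rw [← noisy_one (planar 3), sum_smul_noisy_planar_eq_zero (by norm_num)] at hβ
  obtain ⟨h1, h2, h3⟩ := hβ
  have a0 : angle 3 0 = Real.pi - Real.pi / 3 := by simp [angle]; ring
  have a1 : angle 3 1 = Real.pi / 3 + Real.pi := by simp [angle]; ring
  have a2 : angle 3 2 = 2 * Real.pi := by simp [angle]; ring
  simp only [Fin.sum_univ_three, a0, a1, a2, Real.cos_pi_sub, Real.sin_pi_sub, Real.cos_add_pi,
    Real.sin_add_pi, Real.cos_two_pi, Real.sin_two_pi, Real.cos_pi_div_three,
    Real.sin_pi_div_three] at h1 h2 h3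
  have h4 : β 0 = β 1 := by
    have h5 : √3 * (β 0 - β 1) = 0 := by linarith
    have := (mul_eq_zero.mp h5).resolve_left (by positivity)
    linarith
  intro b
  fin_cases b <;> simp only [Fin.zero_eta, Fin.mk_one, Fin.reduceFinMk] <;> linarith

/-! ### The dual program and the spectral norm -/

/-- Weak duality: a simulation of the noisy measurement by vertices bounds the dual objective. -/
lemma le_dualObjective {n B L : Type} [Fintype n] [DecidableEq n] [Fintype B] [Fintype L]
    {M X : B → Matrix n n ℂ} {G : L → Matrix n n ℂ} {D : L → B → ℝ} {η : ℝ} (h1 : η ≤ 1)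
    (hM : ∀ b, (M b).IsHermitian) (hG : IsPOVM G) (hD : ∀ l, D l ∈ vertexAssignments M)
    (h : ∀ b, ∑ l, D l b • G l = noisy M η b) (hX : DualFeasible M X) :
    η ≤ dualObjective M X := by
  obtain ⟨-, hT, hP⟩ := hX
  have hpos : 0 ≤ ∑ b, (X b * noisy M η b).trace.re := by
    -- Substituting the simulation turns the pairing with `X` into a sum of traces of products of
    -- positive matrices.
    have e : ∑ b, (X b * noisy M η b).trace.re = ∑ l, (G l * ∑ b, D l b • X b).trace.re := by
      simp only [← h, Finset.mul_sum, Matrix.trace_sum, Complex.re_sum]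
      rw [Finset.sum_comm]
      refine Finset.sum_congr rfl fun l _ => Finset.sum_congr rfl fun b _ => ?_
      rw [Matrix.mul_smul, Matrix.mul_smul, Matrix.trace_smul, Matrix.trace_smul,
        Matrix.trace_mul_comm]
    rw [e]
    exact Finset.sum_nonneg fun l _ => trace_mul_re_nonneg (hG.1 l) (hP _ (hD l))
  have hexp : ∑ b, (X b * noisy M η b).trace.re = η * ∑ b, (X b * M b).trace.re +
      (1 - η) * (1 / (Fintype.card n : ℝ) * ∑ b, (X b).trace.re * (M b).trace.re) := by
    rw [Finset.mul_sum, Finset.mul_sum, Finset.mul_sum, ← Finset.sum_add_distrib]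
    refine Finset.sum_congr rfl fun b _ => ?_
    have ht : (M b).trace = (((M b).trace.re : ℝ) : ℂ) := by
      refine (Complex.conj_eq_iff_re.mp ?_).symm
      rw [← Complex.star_def, ← Matrix.trace_conjTranspose, (hM b).eq]
    have hz : (((1 - η : ℝ) : ℂ) * ((M b).trace / (Fintype.card n : ℂ))) =
        (((1 - η) * ((M b).trace.re / Fintype.card n) : ℝ) : ℂ) := by
      conv_lhs => rw [ht]
      push_cast; ring
    rw [noisy, hz, mul_add, Matrix.mul_smul, Matrix.mul_smul, mul_one, Matrix.trace_add,
      Matrix.trace_smul, Matrix.trace_smul, Complex.add_re, smul_eq_mul, smul_eq_mul,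
      Complex.re_ofReal_mul, Complex.re_ofReal_mul]
    ring
  rw [hexp] at hpos
  -- Positivity reads `0 ≤ η S + (1 - η) T`, with `S` and `T` the sums in `hexp`. Feasibility gives
  -- `T ≤ 1 + S`, hence `η ≤ 1 + S`.
  have h2 := mul_le_mul_of_nonneg_left hT (sub_nonneg.mpr h1)
  rw [dualObjective]
  linarith

/-- The mixture of the effects along a point of the assignment polytope. -/
lemma sum_smul_planar {p : Fin k → ℝ} (hp : p ∈ assignmentPolytope (planar k)) :
    ∑ b, p b • planar k b = bloch (1 / k) (1 / k * ∑ b, p b * Real.cos (angle k b))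
      (1 / k * ∑ b, p b * Real.sin (angle k b)) := by
  simp only [planar_eq, smul_bloch, sum_bloch, ← Finset.sum_mul, hp.2.1, one_mul, Finset.mul_sum,
    mul_left_comm]

lemma exists_dualFeasible (hk : 4 ≤ k) : ∃ α β : ℝ,
    DualFeasible (planar k) (fun b => α • (1 : Matrix (Fin 2) (Fin 2) ℂ) - β • planar k b) ∧
    dualObjective (planar k) (fun b => α • (1 : Matrix (Fin 2) (Fin 2) ℂ) - β • planar k b) =
      1 / (2 * Real.cos (Real.pi / k)) := by
  have hk' : (k : ℝ) ≠ 0 := by exact_mod_cast (by omega : k ≠ 0)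
  have hc := cos_pi_div_pos (k := k) (by omega)
  set κ := 1 / (2 * Real.cos (Real.pi / k)) with hκ
  have hκ0 : 0 < κ := by positivity
  -- With `α = (1 + κ)/2` and `β = k/2`, the scalar parts make the trace constraint an equality, and
  -- positivity of `∑ D_b X_b` becomes the bound `κ` on the mean direction of `D`.
  have hX : ∀ b : Fin k, ((1 + κ) / 2) • (1 : Matrix (Fin 2) (Fin 2) ℂ) - (k / 2 : ℝ) • planar k b =
      bloch (κ / 2) (-(Real.cos (angle k b) / 2)) (-(Real.sin (angle k b) / 2)) := by
    intro b
    rw [planar_eq, ← bloch_one, sub_eq_add_neg, ← neg_smul, smul_bloch, smul_bloch, bloch_add,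
      bloch_inj]
    refine ⟨?_, ?_, ?_⟩ <;> field_simp <;> ring
  have hobj : ∑ b, (bloch (κ / 2) (-(Real.cos (angle k b) / 2)) (-(Real.sin (angle k b) / 2)) *
      planar k b).trace.re = κ - 1 := by
    have e : ∀ b : Fin k, (bloch (κ / 2) (-(Real.cos (angle k b) / 2))
        (-(Real.sin (angle k b) / 2)) * planar k b).trace.re = 1 / k * (κ - 1) := by
      intro b
      rw [planar_eq, bloch_mul_trace, Complex.ofReal_re]
      linear_combination (-1 / k : ℝ) * Real.cos_sq_add_sin_sq (angle k b)
    rw [Finset.sum_congr rfl fun b _ => e b]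
    simp; field_simp
  refine ⟨(1 + κ) / 2, k / 2, ?_, ?_⟩
  · simp only [hX]
    refine ⟨fun b => bloch_isHermitian _ _ _, ?_, fun D hD => ?_⟩
    · rw [hobj]
      simp only [bloch_trace, planar_eq, Complex.ofReal_re]
      simp
      field_simp
      norm_num
    · have hrad := assignment_radius (by omega) hD.1
      have hR : (1 / Real.cos (Real.pi / k)) ^ 2 = (2 * κ) ^ 2 := by rw [hκ]; field_simp
      rw [hR] at hrad
      have e : ∀ f : Fin k → ℝ, ∑ b, D b * -(f b / 2) = -(1 / 2) * ∑ b, D b * f b := by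
        intro f; rw [Finset.mul_sum]; exact Finset.sum_congr rfl fun b _ => by ring
      simp only [smul_bloch, sum_bloch, ← Finset.sum_mul, hD.1.2.1, one_mul, e]
      exact bloch_posSemidef (by positivity) (by linarith)
  · rw [dualObjective]
    simp only [hX, hobj]
    ring

/-- The largest spectral norm of a mixture of the effects along a vertex. -/
lemma isGreatest_spectralNorm (hk : 4 ≤ k) :
    IsGreatest ((fun D : Fin k → ℝ => spectralNorm (∑ b, D b • planar k b)) ''
      vertexAssignments (planar k)) (1 / k * (1 + 1 / (2 * Real.cos (Real.pi / k)))) := by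
  have hk' : (0 : ℝ) < k := by exact_mod_cast (by omega : 0 < k)
  have hc := cos_pi_div_pos (k := k) (by omega)
  constructor
  · refine ⟨planarVertex k ⟨0, by omega⟩,
      planarVertex_mem_vertexAssignments (by omega) _, ?_⟩
    obtain ⟨m1, m2⟩ := planarVertex_moments (k := k) (by omega) ⟨0, by omega⟩
    dsimp only
    rw [sum_smul_planar (planarVertex_mem (by omega) _),
      spectralNorm_bloch (s := 1 / k * (1 / (2 * Real.cos (Real.pi / k)))) (by positivity)
        (by positivity), mul_add, mul_one]
    have m1' := congrArg (· / 2) m1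
    have m2' := congrArg (· / 2) m2
    simp only [mul_div_cancel_left₀ _ (two_ne_zero' ℝ)] at m1' m2'
    rw [m1', m2']
    linear_combination (1 / k * (1 / (2 * Real.cos (Real.pi / k)))) ^ 2 *
      Real.cos_sq_add_sin_sq (angle k ⟨0, by omega⟩ + parentShift k)
  · rintro _ ⟨D, hD, rfl⟩
    have hrad := assignment_radius (by omega) hD.1
    dsimp only
    rw [sum_smul_planar hD.1]
    set u := ∑ b, D b * Real.cos (angle k b)
    set w := ∑ b, D b * Real.sin (angle k b)
    rw [mul_add, mul_one]
    have hsq : (1 / k * u) ^ 2 + (1 / k * w) ^ 2 ≤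
        (1 / k * (1 / (2 * Real.cos (Real.pi / k)))) ^ 2 := by
      have e1 : (1 / k * u) ^ 2 + (1 / k * w) ^ 2 =
        (1 / (2 * k : ℝ)) ^ 2 * ((2 * u) ^ 2 + (2 * w) ^ 2) := by field_simp
      have e2 : (1 / k * (1 / (2 * Real.cos (Real.pi / k)))) ^ 2 =
        (1 / (2 * k : ℝ)) ^ 2 * (1 / Real.cos (Real.pi / k)) ^ 2 := by field_simp
      rw [e1, e2]
      exact mul_le_mul_of_nonneg_left hrad (sq_nonneg _)
    refine (spectralNorm_bloch_le (by positivity)).trans ?_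
    gcongr
    exact (Real.sqrt_le_left (by positivity)).mpr hsq

end planar
end NCMeas
end

theorem mainTheorem9 :
    -- the planar measurements are POVMs
    (∀ k : ℕ, 2 ≤ k → NCMeas.IsPOVM (NCMeas.planar k)) ∧
    -- they are classical for fewer than four outcomes
    (∀ k : ℕ, 2 ≤ k → k < 4 →
      NCMeas.IsClassical (NCMeas.planar k) ∧
      NCMeas.whiteNoiseRobustness (NCMeas.planar k) = 1) ∧
    (∀ k : ℕ, 4 ≤ k →
      -- the white-noise robustness is the critical parameter `1 / (2 cos (π / k))`
      NCMeas.whiteNoiseRobustness (NCMeas.planar k) = 1 / (2 * Real.cos (Real.pi / k)) ∧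
      (∀ η : ℝ, 0 ≤ η → η ≤ 1 →
        (NCMeas.IsClassical (NCMeas.noisy (NCMeas.planar k) η) ↔
          η ≤ 1 / (2 * Real.cos (Real.pi / k)))) ∧
      -- it is the minimum of the dual program, attained at variables `α 𝟙 - β M_b`
      (∀ X : Fin k → Matrix (Fin 2) (Fin 2) ℂ, NCMeas.DualFeasible (NCMeas.planar k) X →
        1 / (2 * Real.cos (Real.pi / k)) ≤ NCMeas.dualObjective (NCMeas.planar k) X) ∧
      (∃ α β : ℝ,
        NCMeas.DualFeasible (NCMeas.planar k)
          (fun b => α • (1 : Matrix (Fin 2) (Fin 2) ℂ) - β • NCMeas.planar k b) ∧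
        NCMeas.dualObjective (NCMeas.planar k)
          (fun b => α • (1 : Matrix (Fin 2) (Fin 2) ℂ) - β • NCMeas.planar k b) =
            1 / (2 * Real.cos (Real.pi / k))) ∧
      -- it equals the bound `(k Λ - 1) / (d - 1)` with `d = 2`
      (∃ L : ℝ,
        IsGreatest
          ((fun D : Fin k → ℝ => NCMeas.spectralNorm (∑ b, D b • NCMeas.planar k b)) ''
            NCMeas.vertexAssignments (NCMeas.planar k)) L ∧
        ((k : ℝ) * L - 1) / (2 - 1) = 1 / (2 * Real.cos (Real.pi / k))) ∧
      -- and the explicit parent POVM simulates the noisy measurement at that value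
      NCMeas.IsPOVM (NCMeas.planarParent k) ∧
      (∃ D : Fin k → Fin k → ℝ,
        (∀ l, D l ∈ NCMeas.vertexAssignments (NCMeas.planar k)) ∧
        ∀ b, ∑ l, D l b • NCMeas.planarParent k l =
          NCMeas.noisy (NCMeas.planar k) (1 / (2 * Real.cos (Real.pi / k))) b)) := by
  refine ⟨fun k hk => NCMeas.isPOVM_planar hk, fun k h2 h4 => ?_, fun k hk => ?_⟩
  · have h : NCMeas.IsClassical (NCMeas.planar k) := by
      interval_cases k
      · exact NCMeas.isClassical_planar_two
      · exact NCMeas.isClassical_planar_three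
    exact ⟨h, NCMeas.whiteNoiseRobustness_eq_one h⟩
  · have hk' : (k : ℝ) ≠ 0 := by exact_mod_cast (by omega : k ≠ 0)
    have hc := NCMeas.cos_pi_div_pos (k := k) (by omega)
    have hV := NCMeas.planarVertex_mem_vertexAssignments (k := k) (by omega)
    have hG := NCMeas.isPOVM_planarParent (k := k) (by omega)
    have hsim : ∀ b, ∑ l, NCMeas.planarVertex k l b • NCMeas.planarParent k l =
        NCMeas.noisy (NCMeas.planar k) (1 / (2 * Real.cos (Real.pi / k))) b := by
      intro b
      rw [← NCMeas.sum_smul_planarParent (by omega)]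
      refine Finset.sum_congr rfl fun l _ => ?_
      congr 1
      rw [NCMeas.planarVertex]
      field_simp
    refine ⟨NCMeas.whiteNoiseRobustness_planar hk,
      fun η h0 _ => NCMeas.isClassical_noisy_planar_iff hk h0, fun X hX => ?_,
      NCMeas.exists_dualFeasible hk, ⟨_, NCMeas.isGreatest_spectralNorm hk, ?_⟩, hG, _, hV, hsim⟩
    · exact NCMeas.le_dualObjective (NCMeas.critical_mem_Icc hk).2
        (fun b => ((NCMeas.isPOVM_planar (by omega)).1 b).isHermitian) hG hV hsim hX
    · field_simp
      ring
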